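/- Let $k\ge 1$ and let $\mathcal W_k$ be the set of infinite words $s=s_1s_2s_3\dots$ over the alphabet $\{0,1,\dots,k-1\}$, linearly ordered as follows: if $s\ne t$ and $j\ge1$ is the smallest index with $s_j\ne t_j$, then $s\prec t$ if either $j-1$ is even and $s_j<t_j$, or $j-1$ is odd and $s_j>t_j$. The reverse $k$-shift is the map $\Sigma^-_k:\mathcal W_k\to\mathcal W_k$, $\Sigma^-_k(s_1s_2s_3\dots)=s_2s_3s_4\dots$. For a map $f:X\to X$ on a linearly ordered set $X$, a point $x$ is $n$-periodic if $f^n(x)=x$ and $f^i(x)\ne x$ for $1\le i<n$; its periodic pattern is the permutation $\pi=\pi_1\pi_2\dots\pi_n$ of $\{1,\dots,n\}$ whose entries are in the same relative order as $x,f(x),\dots,f^{n-1}(x)$. Let $p_n(f)$ be the number of equivalence classes $[\pi]=\{\pi_i\pi_{i+1}\dots\pi_n\pi_1\dots\pi_{i-1}:1\le i\le n\}$ of periodic patterns $\pi$ of $n$-periodic points of $f$. Let $C'(n,i)$ be the number of permutations $\tau=\tau_1\tau_2\dots\tau_n$ of $\{1,\dots,n\}$ that consist of a single cycle of length $n$ and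 have exactly $i-1$ ascents (indices $j\in\{1,\dots,n-1\}$ with $\tau_j<\tau_{j+1}$); in particular $C'(n,i)=0$ for $i>n$. **Theorem.** For all integers $n\ge3$ with $n\equiv 2\pmod 4$ and all integers $k\ge3$, $$p_n(\Sigma^-_k)=\sum_{i=2}^k C'(n,i)-C'\!\left(\frac n2,k\right).$$ -/

import Mathlib

/-! ### Periodic patterns of a map on a linearly ordered set -/

/-- `x` is an `n`-periodic point of `f`: `f^n(x) = x`, but `f^i(x) ≠ x` for `1 ≤ i < n`. -/
def IsPeriodicPoint {X : Type*} (f : X → X) (n : ℕ) (x : X) : Prop :=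
  f^[n] x = x ∧ ∀ i : ℕ, 1 ≤ i → i < n → f^[i] x ≠ x

/-- `π` is the pattern of length `n` of `f` at `x`: the entries of the one-line notation
`π 0, π 1, …, π (n - 1)` are in the same relative order as `x, f x, …, f^(n-1) x`
(positions and values of permutations are indexed from `0`). There is at most one such `π`, and
there is none if two of the first `n` iterates coincide. -/
def IsPattern {X : Type*} [LinearOrder X] (f : X → X) (n : ℕ) (x : X)
    (π : Equiv.Perm (Fin n)) : Prop :=
  ∀ i j : Fin n, π i < π j ↔ f^[(i : ℕ)] x < f^[(j : ℕ)] x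

/-- The set of periodic patterns of `f` of length `n`. -/
def periodicPatterns {X : Type*} [LinearOrder X] (f : X → X) (n : ℕ) :
    Set (Equiv.Perm (Fin n)) :=
  {π | ∃ x : X, IsPeriodicPoint f n x ∧ IsPattern f n x π}

/-- The set `[π]` of cyclic rotations of the one-line notation of `π`. -/
def rotationClass {n : ℕ} (π : Equiv.Perm (Fin n)) : Set (Equiv.Perm (Fin n)) :=
  {ρ | ∃ c : ℕ, ρ = π * finRotate n ^ c}

/-- `p_n(f)`: the number of classes `[π]` of periodic patterns `π` of `f` of length `n`. -/
noncomputable def numPeriodicPatterns {X : Type*} [LinearOrder X] (f : X → X) (n : ℕ) : ℕ :=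
  (rotationClass '' periodicPatterns f n).ncard

/-! ### Signed shifts -/

/-- Infinite words over the alphabet `{0, …, k - 1}`; the signature `σ`, which assigns `1` or `-1`
to every letter, only determines the linear order below. -/
def SignedWord {k : ℕ} (_σ : Fin k → ℤˣ) : Type := ℕ → Fin k

namespace SignedWord

variable {k : ℕ} {σ : Fin k → ℤˣ}

/-- The number of letters of sign `-1` among the first `j` letters of `s`. -/
def negCount (s : SignedWord σ) (j : ℕ) : ℕ :=
  ((Finset.range j).filter (fun i => σ (s i) = -1)).card

/-- The strict order on words: at the first position `j` where `s` and `t` differ, `s j < t j` if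
the common prefix contains an even number of letters of sign `-1`, and `t j < s j` otherwise. -/
def Prec (s t : SignedWord σ) : Prop :=
  ∃ j : ℕ, (∀ i < j, s i = t i) ∧
    ((Even (s.negCount j) ∧ s j < t j) ∨ (Odd (s.negCount j) ∧ t j < s j))

theorem negCount_congr {s t : SignedWord σ} {j : ℕ} (h : ∀ i < j, s i = t i) :
    s.negCount j = t.negCount j := by
  unfold negCount
  congr 1
  apply Finset.filter_congr
  intro i hi
  rw [h i (Finset.mem_range.1 hi)]

theorem prec_irrefl (s : SignedWord σ) : ¬ s.Prec s := by
  rintro ⟨j, -, h | h⟩ <;> exact lt_irrefl _ h.2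

theorem prec_trans {s t u : SignedWord σ} (hst : s.Prec t) (htu : t.Prec u) : s.Prec u := by
  obtain ⟨a, ha, hsa⟩ := hst
  obtain ⟨b, hb, htb⟩ := htu
  have hn := negCount_congr ha
  rcases lt_trichotomy a b with hab | hab | hab
  · refine ⟨a, fun i hi => (ha i hi).trans (hb i (hi.trans hab)), ?_⟩
    rwa [← hb a hab]
  · subst hab
    refine ⟨a, fun i hi => (ha i hi).trans (hb i hi), ?_⟩
    rw [← hn] at htb
    rcases hsa with ⟨h1, h2⟩ | ⟨h1, h2⟩ <;> rcases htb with ⟨h3, h4⟩ | ⟨h3, h4⟩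
    · exact Or.inl ⟨h1, h2.trans h4⟩
    · exact absurd h1 (Nat.not_even_iff_odd.2 h3)
    · exact absurd h3 (Nat.not_even_iff_odd.2 h1)
    · exact Or.inr ⟨h1, h4.trans h2⟩
  · have ha' : ∀ i < b, s i = t i := fun i hi => ha i (hi.trans hab)
    refine ⟨b, fun i hi => (ha' i hi).trans (hb i hi), ?_⟩
    rwa [ha b hab, negCount_congr ha']

theorem prec_total {s t : SignedWord σ} (hne : s ≠ t) : s.Prec t ∨ t.Prec s := by
  classical
  have hex : ∃ j, s j ≠ t j := by
    by_contra h
    push Not at h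
    exact hne (funext h)
  have hmin : ∀ i < Nat.find hex, s i = t i := fun i hi => not_not.1 (Nat.find_min hex hi)
  have hn := negCount_congr hmin
  rcases Nat.even_or_odd (s.negCount (Nat.find hex)) with he | ho <;>
    rcases lt_or_gt_of_ne (Nat.find_spec hex) with h | h
  · exact Or.inl ⟨_, hmin, Or.inl ⟨he, h⟩⟩
  · exact Or.inr ⟨_, fun i hi => (hmin i hi).symm, Or.inl ⟨hn ▸ he, h⟩⟩
  · exact Or.inr ⟨_, fun i hi => (hmin i hi).symm, Or.inr ⟨hn ▸ ho, h⟩⟩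
  · exact Or.inl ⟨_, hmin, Or.inr ⟨ho, h⟩⟩

/-- The linear order on words determined by `σ`. -/
noncomputable instance : LinearOrder (SignedWord σ) where
  le s t := s = t ∨ s.Prec t
  lt := Prec
  le_refl s := Or.inl rfl
  le_trans s t u hst htu := by
    rcases hst with rfl | hst
    · exact htu
    · rcases htu with rfl | htu
      · exact Or.inr hst
      · exact Or.inr (prec_trans hst htu)
  lt_iff_le_not_ge s t := by
    constructor
    · intro h
      refine ⟨Or.inr h, ?_⟩
      rintro (rfl | h')
      · exact prec_irrefl _ h
      · exact prec_irrefl _ (prec_trans h h')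
    · rintro ⟨rfl | h, h'⟩
      · exact absurd (Or.inl rfl) h'
      · exact h
  le_antisymm s t hst hts := by
    rcases hst with h | h
    · exact h
    · rcases hts with h' | h'
      · exact h'.symm
      · exact absurd (prec_trans h h') (prec_irrefl _)
  le_total s t := by
    by_cases h : s = t
    · exact Or.inl (Or.inl h)
    · exact (prec_total h).imp Or.inr Or.inr
  toDecidableLE := Classical.decRel _

end SignedWord

/-- The signed shift with signature `σ`: it deletes the first letter of a word. -/
def signedShift {k : ℕ} (σ : Fin k → ℤˣ) : SignedWord σ → SignedWord σ :=
  fun s i => s (i + 1)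

/-- The reverse `k`-shift: the signed shift all of whose signs are `-1`. -/
def reverseShift (k : ℕ) :
    SignedWord (fun _ : Fin k => (-1 : ℤˣ)) → SignedWord (fun _ : Fin k => (-1 : ℤˣ)) :=
  signedShift (fun _ : Fin k => (-1 : ℤˣ))

/-! ### Cyclic permutations with a given number of ascents -/

/-- The number of ascents of `τ`: positions `i` with `τ i < τ (i + 1)`, where `i + 1` is
also a position. -/
def ascCount {n : ℕ} (τ : Equiv.Perm (Fin n)) : ℕ :=
  (Finset.univ.filter
    (fun i : Fin n => ∃ j : Fin n, (j : ℕ) = (i : ℕ) + 1 ∧ τ i < τ j)).card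

/-- `C'(n, i)`: the number of permutations of `n` points that consist of a single cycle of length
`n` and have exactly `i - 1` ascents. -/
noncomputable def numCyclicAsc (n i : ℕ) : ℕ :=
  {τ : Equiv.Perm (Fin n) | τ.IsCycleOn Set.univ ∧ ascCount τ + 1 = i}.ncard

/-!
A rotation class of patterns of length `n` amounts to the cyclic permutation `τ` that describes how
the map permutes the ranks of the points of a periodic orbit
(`numPeriodicPatterns_eq_ncard_realizedCycles`), so the task is to decide which cycles `τ` occur
for the reverse shift. The first letters of the points form a labeling of the ranks: it is weakly
increasing, and `τ` is decreasing on ranks with equal letters. Conversely a labeling by `k` letters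
turns ranks into words, their itineraries, and these words realize `τ` as soon as they are distinct
(`mem_realizedCycles_reverseShift`).

A labeling must change letters at every ascent, so `τ` has at most `k - 1` ascents, and changing
letters exactly at the ascents always gives a labeling (`isLabeling_ascBefore`). Two ranks can have
the same itinerary only if `n = 2 * e` with `e` odd and all opposite ranks `x`, `τ ^ e x` share
their letters: an even power of `τ` preserving the labels is increasing along its orbits, hence
trivial (`pow_even_eq_one`, `opposite_of_itinerary_eq`). If `τ` has fewer than `k - 1` ascents,
the spare letter can be used to separate one opposite pair, so `τ` is realized
(`mem_realizedCycles_of_ascCount_lt`).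

If `τ` has exactly `k - 1` ascents, the labeling is forced (`IsLabeling.eq_ascBefore`), and `τ`
fails to be realized precisely when opposite ranks always share a letter. In that case opposite
ranks are adjacent, since anything between them would have the same itinerary, and `τ` is the
doubling of a cycle of length `n / 2` with as many ascents (`exists_doublePerm_eq`). Doubling
yields a cycle because `n / 2` is odd (`doublePerm_isCycleOn`). So the cycles to be subtracted
correspond to the cycles of length `n / 2` with `k - 1` ascents. Cycles without ascents do not
exist for `n ≥ 3`, which is why the sum starts at `2`.
-/

/-! ### Patterns as order-preserving conjugacies -/

theorem val_finRotate_pow {m : ℕ} (c : ℕ) (i : Fin (m + 1)) :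
    (((finRotate (m + 1) ^ c) i : Fin (m + 1)) : ℕ) = (i + c) % (m + 1) := by
  induction c with
  | zero => simp [Nat.mod_eq_of_lt i.2]
  | succ c ih =>
    rw [pow_succ', Equiv.Perm.mul_apply, finRotate_apply, Fin.val_add, ih, Fin.val_one']
    simp [Nat.add_assoc]

theorem finRotate_isCycleOn (m : ℕ) : (finRotate (m + 1)).IsCycleOn Set.univ := by
  refine ⟨(finRotate (m + 1)).bijective.bijOn_univ, fun i _ j _ => ⟨(j + (m + 1) - i : ℕ), ?_⟩⟩
  rw [zpow_natCast]
  apply Fin.ext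
  rw [val_finRotate_pow, show (i : ℕ) + (j + (m + 1) - i) = j + (m + 1) by omega]
  simp [Nat.mod_eq_of_lt j.2]

/-- A rotation class is a fibre of `π ↦ π * finRotate n * π⁻¹`, because the centralizer of the
rotation consists of its powers. -/
theorem rotationClass_eq {n : ℕ} (hn : n ≠ 0) (π : Equiv.Perm (Fin n)) :
    rotationClass π = {ρ | ρ * finRotate n * ρ⁻¹ = π * finRotate n * π⁻¹} := by
  obtain ⟨m, rfl⟩ := Nat.exists_eq_succ_of_ne_zero hn
  ext ρ
  constructor
  · rintro ⟨c, rfl⟩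
    simp only [Set.mem_ofPred_eq, mul_inv_rev]
    rw [mul_assoc π, ← pow_succ, pow_succ']
    group
  · intro h
    have hc : Commute (π⁻¹ * ρ) (finRotate (m + 1)) := by
      have h' : ρ * finRotate (m + 1) * ρ⁻¹ = π * finRotate (m + 1) * π⁻¹ := h
      have h2 : ρ * finRotate (m + 1) = π * finRotate (m + 1) * π⁻¹ * ρ := by
        rw [← h']; group
      change π⁻¹ * ρ * finRotate (m + 1) = finRotate (m + 1) * (π⁻¹ * ρ)
      rw [mul_assoc, h2]; group
    refine ⟨((π⁻¹ * ρ) 0 : Fin (m + 1)), ?_⟩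
    rw [← inv_mul_eq_iff_eq_mul]
    ext1 i
    have hi : i = (finRotate (m + 1) ^ (i : ℕ)) 0 :=
      Fin.ext (by rw [val_finRotate_pow]; simp [Nat.mod_eq_of_lt i.2])
    apply Fin.ext
    rw [val_finRotate_pow]
    conv_lhs => rw [hi]
    rw [← Equiv.Perm.mul_apply, (hc.pow_right _).eq, Equiv.Perm.mul_apply, val_finRotate_pow,
      add_comm]

/-- The cyclic permutations `τ` for which the map `f` restricts to `τ` on a subset of `X`, the
points of that subset being numbered in increasing order. -/
def realizedCycles {X : Type*} [LinearOrder X] (f : X → X) (n : ℕ) : Set (Equiv.Perm (Fin n)) :=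
  {τ | τ.IsCycleOn Set.univ ∧ ∃ W : Fin n → X, StrictMono W ∧ ∀ p, W (τ p) = f (W p)}

theorem iterate_finRotate {X : Type*} {f : X → X} {n : ℕ} {x : X} (hx : f^[n] x = x) (i : Fin n) :
    f^[(finRotate n i : ℕ)] x = f (f^[(i : ℕ)] x) := by
  obtain ⟨m, rfl⟩ := Nat.exists_eq_succ_of_ne_zero (Fin.pos i).ne'
  rw [← Function.iterate_succ_apply' f]
  rcases eq_or_ne i (Fin.last m) with rfl | h
  · rw [finRotate_last]; simpa using hx.symm
  · rw [coe_finRotate_of_ne_last h]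

theorem cycle_pow_card {n : ℕ} {τ : Equiv.Perm (Fin n)} (h : τ.IsCycleOn Set.univ) : τ ^ n = 1 := by
  ext1 p
  have h' : τ.IsCycleOn (Finset.univ : Finset (Fin n)) := by simpa using h
  simpa using h'.pow_card_apply (Finset.mem_univ p)

theorem cycle_pow_eq_self {n : ℕ} {τ : Equiv.Perm (Fin n)} (h : τ.IsCycleOn Set.univ) (p : Fin n)
    (e : ℕ) : (τ ^ e) p = p ↔ n ∣ e := by
  have h' : τ.IsCycleOn (Finset.univ : Finset (Fin n)) := by simpa using h
  simpa using h'.pow_apply_eq (Finset.mem_univ p) (n := e)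

theorem cycle_exists_pow {n : ℕ} {τ : Equiv.Perm (Fin n)} (h : τ.IsCycleOn Set.univ)
    (p q : Fin n) : ∃ e < n, (τ ^ e) p = q := by
  have h' : τ.IsCycleOn (Finset.univ : Finset (Fin n)) := by simpa using h
  simpa using h'.exists_pow_eq (Finset.mem_univ p) (Finset.mem_univ q)

/-- The permutation attached to a pattern `π` sends `π i` to `π (i + 1)`, cyclically; it records
how `f` permutes the ranks of the points of a periodic orbit. -/
theorem image_conj_periodicPatterns {X : Type*} [LinearOrder X] (f : X → X) {n : ℕ} (hn : n ≠ 0) :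
    (fun π => π * finRotate n * π⁻¹) '' periodicPatterns f n = realizedCycles f n := by
  ext τ
  constructor
  · rintro ⟨π, ⟨x, hx, hπ⟩, rfl⟩
    obtain ⟨m, rfl⟩ := Nat.exists_eq_succ_of_ne_zero hn
    refine ⟨⟨Equiv.bijective _ |>.bijOn_univ, fun p _ q _ => ?_⟩,
      fun p => f^[(π⁻¹ p : Fin (m + 1))] x, fun p q hpq => ?_, fun p => ?_⟩
    · exact Equiv.Perm.sameCycle_conj.2 ((finRotate_isCycleOn m).2 trivial trivial)
    · exact (hπ _ _).1 (by simpa using hpq)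
    · simpa using iterate_finRotate hx.1 (π⁻¹ p)
  · rintro ⟨hτ, W, hW, hf⟩
    have hW' : ∀ (i : ℕ) p, W ((τ ^ i) p) = f^[i] (W p) := by
      intro i
      induction i with
      | zero => simp
      | succ i ih => intro p; rw [pow_succ', Equiv.Perm.mul_apply, hf, ih,
          Function.iterate_succ_apply']
    let o : Fin n := ⟨0, Nat.pos_of_ne_zero hn⟩
    have hτ' : τ.IsCycleOn (Finset.univ : Finset (Fin n)) := by simpa using hτ
    have hinj : Function.Injective fun i : Fin n => (τ ^ (i : ℕ)) o := by
      intro i j hij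
      have := (hτ'.pow_apply_eq_pow_apply (Finset.mem_univ o)).1 hij
      rw [Finset.card_univ, Fintype.card_fin] at this
      exact Fin.ext (Nat.ModEq.eq_of_lt_of_lt this i.2 j.2)
    let π : Equiv.Perm (Fin n) := Equiv.ofBijective _ (Finite.injective_iff_bijective.1 hinj)
    have hπ : ∀ i : Fin n, π i = (τ ^ (i : ℕ)) o := fun i => rfl
    refine ⟨π, ⟨W o, ⟨?_, fun i hi hin h => ?_⟩, fun i j => ?_⟩, ?_⟩
    · rw [← hW', cycle_pow_card hτ]; rfl
    · rw [← hW'] at h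
      have := (cycle_pow_eq_self hτ o i).1 (hW.injective h)
      exact absurd (Nat.le_of_dvd hi this) (not_le.2 hin)
    · rw [← hW', ← hW', hW.lt_iff_lt, hπ, hπ]
    · change π * finRotate n * π⁻¹ = τ
      rw [mul_inv_eq_iff_eq_mul]
      ext1 i
      apply hW.injective
      rw [Equiv.Perm.mul_apply, Equiv.Perm.mul_apply, hf, hπ, hπ, hW', hW', iterate_finRotate]
      rw [← hW', cycle_pow_card hτ]; rfl

theorem numPeriodicPatterns_eq_ncard_realizedCycles {X : Type*} [LinearOrder X] (f : X → X) {n : ℕ}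
    (hn : n ≠ 0) : numPeriodicPatterns f n = (realizedCycles f n).ncard := by
  rw [numPeriodicPatterns, ← image_conj_periodicPatterns f hn]
  have h : rotationClass '' periodicPatterns f n =
      (fun τ => {ρ : Equiv.Perm (Fin n) | ρ * finRotate n * ρ⁻¹ = τ}) ''
        ((fun π => π * finRotate n * π⁻¹) '' periodicPatterns f n) := by
    rw [Set.image_image]
    exact Set.image_congr fun π _ => rotationClass_eq hn π
  rw [h, Set.InjOn.ncard_image]
  rintro _ ⟨π, -, rfl⟩ τ - h
  have : π ∈ {ρ : Equiv.Perm (Fin n) | ρ * finRotate n * ρ⁻¹ = τ} := by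
    rw [← show _ = {ρ : Equiv.Perm (Fin n) | ρ * finRotate n * ρ⁻¹ = τ} from h]
    rfl
  exact this

/-! ### Labelings and their itineraries -/

/-- A labeling of a permutation `τ` assigns letters to the positions, weakly increasing from left
to right, such that `τ` is decreasing on every set of positions with a common letter. -/
structure IsLabeling {n : ℕ} {α : Type*} [Preorder α] (τ : Equiv.Perm (Fin n)) (L : Fin n → α) :
    Prop where
  monotone : Monotone L
  anti : ∀ p q, p < q → L p = L q → τ q < τ p

/-- The itinerary of a position `p`: the letters met along the orbit of `p` under `τ`. -/
def itinerary {n : ℕ} {α : Type*} (τ : Equiv.Perm (Fin n)) (L : Fin n → α) (p : Fin n) : ℕ → α :=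
  fun m => L ((τ ^ m) p)

/-- As long as the itineraries agree, every application of `τ` reverses the order. -/
theorem pow_lt_of_itinerary_agree {n : ℕ} {α : Type*} [Preorder α] {τ : Equiv.Perm (Fin n)}
    {L : Fin n → α} (hL : IsLabeling τ L) {p q : Fin n} (hpq : p < q) (m : ℕ)
    (h : ∀ i < m, itinerary τ L p i = itinerary τ L q i) :
    (Even m → (τ ^ m) p < (τ ^ m) q) ∧ (Odd m → (τ ^ m) q < (τ ^ m) p) := by
  induction m with
  | zero => simpa using hpq
  | succ m ih =>
    have ih := ih fun i hi => h i (by omega)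
    have hm : L ((τ ^ m) p) = L ((τ ^ m) q) := h m (by omega)
    simp only [pow_succ', Equiv.Perm.mul_apply]
    constructor
    · intro he
      exact hL.anti _ _ (ih.2 (by grind)) hm.symm
    · intro ho
      exact hL.anti _ _ (ih.1 (by grind)) hm

theorem negCount_reverse {k : ℕ} (s : SignedWord (fun _ : Fin k => (-1 : ℤˣ))) (j : ℕ) :
    s.negCount j = j := by
  simp [SignedWord.negCount]

theorem reverse_lt_iff {k : ℕ} {s t : SignedWord (fun _ : Fin k => (-1 : ℤˣ))} :
    s < t ↔ ∃ j : ℕ, (∀ i < j, s i = t i) ∧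
      ((Even j ∧ s j < t j) ∨ (Odd j ∧ t j < s j)) := by
  change s.Prec t ↔ _
  simp only [SignedWord.Prec, negCount_reverse]

theorem head_le_of_reverse_lt {k : ℕ} {s t : SignedWord (fun _ : Fin k => (-1 : ℤˣ))}
    (h : s < t) : s 0 ≤ t 0 := by
  obtain ⟨j, hj, h⟩ := reverse_lt_iff.1 h
  rcases j with _ | j
  · simpa using (h.resolve_right (by simp)).2.le
  · exact (hj 0 (by omega)).le

theorem reverseShift_lt_of_lt {k : ℕ} {s t : SignedWord (fun _ : Fin k => (-1 : ℤˣ))}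
    (h : s < t) (h0 : s 0 = t 0) : reverseShift k t < reverseShift k s := by
  obtain ⟨j, hj, h⟩ := reverse_lt_iff.1 h
  rcases j with _ | j
  · simp [h0] at h
  · refine reverse_lt_iff.2 ⟨j, fun i hi => (hj (i + 1) (by omega)).symm, ?_⟩
    rcases h with ⟨h1, h2⟩ | ⟨h1, h2⟩
    · exact Or.inr ⟨by grind, h2⟩
    · exact Or.inl ⟨by grind, h2⟩

/-- A cyclic permutation is realized by the reverse shift exactly when it has a labeling by `k`
letters for which distinct positions have distinct itineraries. -/
theorem mem_realizedCycles_reverseShift {n k : ℕ} {τ : Equiv.Perm (Fin n)} :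
    τ ∈ realizedCycles (reverseShift k) n ↔ τ.IsCycleOn Set.univ ∧
      ∃ L : Fin n → ℕ, (∀ p, L p < k) ∧ IsLabeling τ L ∧ Function.Injective (itinerary τ L) := by
  refine and_congr_right fun _ => ?_
  constructor
  · rintro ⟨W, hW, hf⟩
    have hf' : ∀ m p j, W ((τ ^ m) p) j = W p (j + m) := by
      intro m
      induction m with
      | zero => simp
      | succ m ih =>
        intro p j
        rw [pow_succ', Equiv.Perm.mul_apply, hf]
        change W _ (j + 1) = _
        rw [ih]; congr 1; omega
    refine ⟨fun p => (W p 0 : Fin k), fun p => (W p 0).2, ⟨?_, ?_⟩, ?_⟩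
    · intro p q hpq
      rcases hpq.eq_or_lt with rfl | hpq
      · exact le_rfl
      · exact head_le_of_reverse_lt (hW hpq)
    · intro p q hpq h
      rw [← hW.lt_iff_lt, hf, hf]
      exact reverseShift_lt_of_lt (hW hpq) (Fin.ext h)
    · intro p q h
      apply hW.injective
      funext m
      have := congrFun h m
      simp only [itinerary, hf', zero_add] at this
      exact Fin.ext this
  · rintro ⟨L, hk, hL, hinj⟩
    refine ⟨fun p m => ⟨itinerary τ L p m, hk _⟩, fun p q hpq => ?_, fun p => ?_⟩
    · have hex : ∃ m, itinerary τ L p m ≠ itinerary τ L q m :=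
        Function.ne_iff.1 (hinj.ne hpq.ne)
      classical
      have hmin : ∀ i < Nat.find hex, itinerary τ L p i = itinerary τ L q i :=
        fun i hi => not_not.1 (Nat.find_min hex hi)
      have hlt := pow_lt_of_itinerary_agree hL hpq _ hmin
      refine reverse_lt_iff.2 ⟨Nat.find hex, fun i hi => Fin.ext (hmin i hi), ?_⟩
      rcases Nat.even_or_odd (Nat.find hex) with he | ho
      · exact Or.inl ⟨he, lt_of_le_of_ne (hL.monotone (hlt.1 he).le)
          fun h => Nat.find_spec hex (Fin.val_eq_of_eq h)⟩
      · exact Or.inr ⟨ho, lt_of_le_of_ne (hL.monotone (hlt.2 ho).le)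
          fun h => Nat.find_spec hex (Fin.val_eq_of_eq h).symm⟩
    · funext m
      apply Fin.ext
      change L ((τ ^ m) (τ p)) = L ((τ ^ (m + 1)) p)
      rw [pow_succ, Equiv.Perm.mul_apply]

/-- An even power of `τ` that preserves all labels is increasing along its own orbits, so it has
no nontrivial orbits. -/
theorem pow_even_eq_one {n : ℕ} {α : Type*} [Preorder α] {τ : Equiv.Perm (Fin n)}
    {L : Fin n → α} (hL : IsLabeling τ L) {e : ℕ} (he : Even e) (h : ∀ p, L ((τ ^ e) p) = L p) :
    τ ^ e = 1 := by
  have hit : ∀ p i, itinerary τ L p i = itinerary τ L ((τ ^ e) p) i := by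
    intro p i
    simp only [itinerary]
    rw [← Equiv.Perm.mul_apply, ← pow_add, add_comm, pow_add, Equiv.Perm.mul_apply, h]
  have hstep : ∀ p i, itinerary τ L (((τ ^ e) ^ i) p) = itinerary τ L p := by
    intro p i
    induction i with
    | zero => rfl
    | succ i ih => rw [pow_succ', Equiv.Perm.mul_apply, ← ih]; exact (funext (hit _)).symm
  ext1 p
  by_contra hne
  have hfix : ((τ ^ e) ^ orderOf (τ ^ e)) p = p := by rw [pow_orderOf_eq_one]; rfl
  have hpos : 0 < orderOf (τ ^ e) := orderOf_pos _
  obtain ⟨N, hN⟩ := Nat.exists_eq_succ_of_ne_zero hpos.ne'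
  rw [hN] at hfix
  rcases lt_or_gt_of_ne hne with hlt | hlt
  · have hmono : ∀ i, ((τ ^ e) ^ (i + 1)) p < p := by
      intro i
      induction i with
      | zero => simpa using hlt
      | succ i ih =>
        refine lt_trans ?_ hlt
        rw [pow_succ', Equiv.Perm.mul_apply]
        exact (pow_lt_of_itinerary_agree hL ih e fun j _ => congrFun (hstep p _) j).1 he
    exact absurd hfix (hmono N).ne
  · have hmono : ∀ i, p < ((τ ^ e) ^ (i + 1)) p := by
      intro i
      induction i with
      | zero => simpa using hlt
      | succ i ih =>
        refine lt_trans hlt ?_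
        rw [pow_succ' _ (i + 1), Equiv.Perm.mul_apply]
        exact (pow_lt_of_itinerary_agree hL ih e fun j _ => (congrFun (hstep p _) j).symm).1 he
    exact absurd hfix (hmono N).ne'

/-- Two positions of a cycle with the same itinerary are opposite on the cycle, the length of the
cycle is twice an odd number, and then all opposite positions carry the same letter. -/
theorem opposite_of_itinerary_eq {n : ℕ} {α : Type*} [Preorder α] {τ : Equiv.Perm (Fin n)}
    {L : Fin n → α} (hτ : τ.IsCycleOn Set.univ) (hL : IsLabeling τ L) {p q : Fin n} (hpq : p ≠ q)
    (h : itinerary τ L p = itinerary τ L q) :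
    ∃ e, n = 2 * e ∧ Odd e ∧ q = (τ ^ e) p ∧ ∀ x, L ((τ ^ e) x) = L x := by
  obtain ⟨e, hen, rfl⟩ := cycle_exists_pow hτ p q
  have hall : ∀ x, L ((τ ^ e) x) = L x := by
    intro x
    obtain ⟨i, -, rfl⟩ := cycle_exists_pow hτ p x
    have := congrFun h i
    simp only [itinerary] at this
    rw [← Equiv.Perm.mul_apply, ← pow_add, add_comm, pow_add, Equiv.Perm.mul_apply, ← this]
  have hne : ¬ n ∣ e := fun hd => hpq ((cycle_pow_eq_self hτ p e).2 hd).symm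
  have he0 : e ≠ 0 := by rintro rfl; exact hne (dvd_zero n)
  have hodd : Odd e := by
    by_contra ho
    have := pow_even_eq_one hL (Nat.not_odd_iff_even.1 ho) hall
    exact hpq (by rw [this]; rfl)
  have h2 : τ ^ (2 * e) = 1 := by
    refine pow_even_eq_one hL (even_two_mul e) fun x => ?_
    rw [two_mul, pow_add, Equiv.Perm.mul_apply, hall, hall]
  have hdvd : n ∣ 2 * e := (cycle_pow_eq_self hτ p _).1 (by rw [h2]; rfl)
  obtain ⟨c, hc⟩ := hdvd
  have hc1 : c = 1 := by
    have : c < 2 := by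
      by_contra hc2
      have : n * 2 ≤ n * c := Nat.mul_le_mul_left n (by omega)
      omega
    interval_cases c
    · omega
    · rfl
  exact ⟨e, by rw [hc, hc1, mul_one], hodd, rfl, hall⟩

/-! ### Ascents -/

open Classical in
/-- The number of ascents of `τ` at positions before `p`. -/
noncomputable def ascBefore {n : ℕ} (τ : Equiv.Perm (Fin n)) (p : Fin n) : ℕ :=
  (Finset.univ.filter (fun i : Fin n => i < p ∧ ∃ j : Fin n, (j : ℕ) = (i : ℕ) + 1 ∧ τ i < τ j)).card

theorem ascBefore_le_ascCount {n : ℕ} (τ : Equiv.Perm (Fin n)) (p : Fin n) :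
    ascBefore τ p ≤ ascCount τ := by
  classical
  apply Finset.card_le_card
  intro i
  simp only [Finset.mem_filter, Finset.mem_univ, true_and]
  exact And.right

theorem ascBefore_last {n : ℕ} (τ : Equiv.Perm (Fin n)) (p : Fin n) (hp : (p : ℕ) + 1 = n) :
    ascBefore τ p = ascCount τ := by
  classical
  refine le_antisymm (ascBefore_le_ascCount τ p) (Finset.card_le_card ?_)
  intro i
  simp only [Finset.mem_filter, Finset.mem_univ, true_and]
  rintro ⟨j, hj, h⟩
  exact ⟨Fin.lt_def.2 (by omega), j, hj, h⟩

theorem ascBefore_mono {n : ℕ} (τ : Equiv.Perm (Fin n)) : Monotone (ascBefore τ) := by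
  classical
  intro p q hpq
  apply Finset.card_le_card
  intro i
  simp only [Finset.mem_filter, Finset.mem_univ, true_and]
  exact fun h => ⟨h.1.trans_le hpq, h.2⟩

theorem ascBefore_zero {n : ℕ} (τ : Equiv.Perm (Fin n)) (p : Fin n) (hp : (p : ℕ) = 0) :
    ascBefore τ p = 0 := by
  classical
  simp only [ascBefore, Finset.card_eq_zero, Finset.filter_eq_empty_iff]
  rintro i - ⟨h, -⟩
  exact absurd (Fin.lt_def.1 h) (by omega)

theorem ascBefore_succ_of_lt {n : ℕ} (τ : Equiv.Perm (Fin n)) {p q : Fin n} (hq : (q : ℕ) = p + 1)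
    (h : τ p < τ q) : ascBefore τ q = ascBefore τ p + 1 := by
  classical
  rw [ascBefore, ascBefore, ← Finset.card_insert_of_notMem (a := p) (by simp)]
  congr 1
  ext i
  simp only [Finset.mem_filter, Finset.mem_univ, true_and, Finset.mem_insert]
  constructor
  · rintro ⟨hi, ha⟩
    by_cases hip : i = p
    · exact Or.inl hip
    · exact Or.inr ⟨by grind, ha⟩
  · rintro (rfl | ⟨hi, ha⟩)
    · exact ⟨by grind, q, hq, h⟩
    · exact ⟨by grind, ha⟩

theorem ascBefore_succ_of_not_lt {n : ℕ} (τ : Equiv.Perm (Fin n)) {p q : Fin n}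
    (hq : (q : ℕ) = p + 1) (h : ¬ τ p < τ q) : ascBefore τ q = ascBefore τ p := by
  classical
  rw [ascBefore, ascBefore]
  congr 1
  ext i
  simp only [Finset.mem_filter, Finset.mem_univ, true_and]
  constructor
  · rintro ⟨hi, j, hj, ha⟩
    refine ⟨?_, j, hj, ha⟩
    by_contra hip
    have h1 : i = p := by grind
    have h2 : j = q := by grind
    subst h1 h2
    exact h ha
  · rintro ⟨hi, ha⟩
    exact ⟨by grind, ha⟩

/-- Induction on the right end point of an interval of positions. -/
theorem fin_interval_induction {n : ℕ} {P : Fin n → Fin n → Prop} (refl : ∀ p, P p p)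
    (step : ∀ p q r : Fin n, p ≤ q → (r : ℕ) = q + 1 → P p q → P p r) {p q : Fin n} (h : p ≤ q) :
    P p q := by
  obtain ⟨q, hq⟩ := q
  induction q with
  | zero => rw [show p = ⟨0, hq⟩ from Fin.ext (by simpa [Fin.le_def] using h)]; exact refl _
  | succ q ih =>
    rcases h.eq_or_lt with rfl | h
    · exact refl _
    · have hle : p ≤ ⟨q, by omega⟩ := by simp [Fin.le_def, Fin.lt_def] at h ⊢; omega
      exact step p _ _ hle rfl (ih _ hle)

/-- The most economical labeling: change letters exactly at the ascents. -/
theorem isLabeling_ascBefore {n : ℕ} (τ : Equiv.Perm (Fin n)) : IsLabeling τ (ascBefore τ) := by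
  refine ⟨ascBefore_mono τ, fun p q hpq h => ?_⟩
  have key : ascBefore τ p = ascBefore τ q → τ q ≤ τ p := by
    refine fin_interval_induction (P := fun p q => ascBefore τ p = ascBefore τ q → τ q ≤ τ p)
      (fun _ _ => le_rfl) (fun p q r hpq hr ih h => ?_) hpq.le
    have h1 := ascBefore_mono τ hpq
    have h2 := ascBefore_mono τ (show q ≤ r by grind)
    have h3 : ¬ τ q < τ r := fun hlt => by
      have := ascBefore_succ_of_lt τ hr hlt
      omega
    exact (not_lt.1 h3).trans (ih (by omega))
  exact lt_of_le_of_ne (key h) (τ.injective.ne hpq.ne')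

/-- A labeling increases at every ascent. -/
theorem IsLabeling.ascBefore_add_le {n : ℕ} {τ : Equiv.Perm (Fin n)} {L : Fin n → ℕ}
    (hL : IsLabeling τ L) {p q : Fin n} (hpq : p ≤ q) :
    ascBefore τ q + L p ≤ ascBefore τ p + L q := by
  refine fin_interval_induction (P := fun p q => ascBefore τ q + L p ≤ ascBefore τ p + L q)
    (fun _ => le_rfl) (fun p q r hpq hr ih => ?_) hpq
  have hqr : q < r := by grind
  have hm := hL.monotone hqr.le
  by_cases h : τ q < τ r
  · have h1 := ascBefore_succ_of_lt τ hr h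
    have h2 : L q ≠ L r := fun h2 => lt_asymm h (hL.anti q r hqr h2)
    omega
  · have h1 := ascBefore_succ_of_not_lt τ hr h
    omega

theorem IsLabeling.ascCount_lt {n k : ℕ} (hn : n ≠ 0) {τ : Equiv.Perm (Fin n)} {L : Fin n → ℕ}
    (hL : IsLabeling τ L) (hk : ∀ p, L p < k) : ascCount τ < k := by
  have h0 := ascBefore_zero τ ⟨0, by omega⟩ rfl
  have h1 := ascBefore_last τ ⟨n - 1, by omega⟩ (by simp; omega)
  have h2 := hL.ascBefore_add_le (p := ⟨0, by omega⟩) (q := ⟨n - 1, by omega⟩) (by simp)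
  have h3 := hk ⟨n - 1, by omega⟩
  omega

/-- A labeling that uses the least possible number of letters is forced to change letters exactly
at the ascents. -/
theorem IsLabeling.eq_ascBefore {n k : ℕ} {τ : Equiv.Perm (Fin n)} {L : Fin n → ℕ}
    (hL : IsLabeling τ L) (hk : ∀ p, L p < k) (hasc : ascCount τ + 1 = k) : L = ascBefore τ := by
  funext p
  have hp := p.2
  have h0 := ascBefore_zero τ ⟨0, by omega⟩ rfl
  have h1 := ascBefore_last τ ⟨n - 1, by omega⟩ (by simp; omega)
  have h2 := hL.ascBefore_add_le (p := ⟨0, by omega⟩) (q := p) (by simp [Fin.le_def])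
  have h4 := hL.ascBefore_add_le (p := p) (q := ⟨n - 1, by omega⟩) (by simp [Fin.le_def]; omega)
  have h3 := hk ⟨n - 1, by omega⟩
  omega

/-- With a letter to spare, an extra change of letters separates two opposite positions. -/
theorem mem_realizedCycles_of_ascCount_lt {n k : ℕ} {τ : Equiv.Perm (Fin n)}
    (hn : n ≠ 0) (hτ : τ.IsCycleOn Set.univ) (h : ascCount τ + 1 < k) :
    τ ∈ realizedCycles (reverseShift k) n := by
  rw [mem_realizedCycles_reverseShift]
  let o : Fin n := ⟨0, Nat.pos_of_ne_zero hn⟩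
  let y := (τ ^ (n / 2)) o
  have hstep : Monotone fun p : Fin n => if y ≤ p then 1 else 0 := by
    intro p q hpq
    dsimp only
    split_ifs <;> omega
  have hLab : IsLabeling τ fun p => ascBefore τ p + if y ≤ p then 1 else 0 := by
    refine ⟨(ascBefore_mono τ).add hstep, fun p q hpq h => ?_⟩
    have h1 := ascBefore_mono τ hpq.le
    have h2 := hstep hpq.le
    dsimp only at h h2
    exact (isLabeling_ascBefore τ).anti p q hpq (by omega)
  refine ⟨hτ, _, fun p => ?_, hLab, fun p q hpq => ?_⟩
  · have := ascBefore_le_ascCount τ p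
    split_ifs <;> omega
  · by_contra hne
    obtain ⟨e, he, hodd, -, hall⟩ := opposite_of_itinerary_eq hτ hLab hne hpq
    have hy : (τ ^ e) o = y := by
      have hn2 : n / 2 = e := by omega
      change _ = (τ ^ (n / 2)) o
      rw [hn2]
    have h1 := hall o
    have h0 := ascBefore_zero τ o rfl
    have hyo : ¬ y ≤ o := by
      intro hle
      have h2 : (τ ^ e) o = o := by
        rw [hy]; exact Fin.ext (by simpa [Fin.le_def, o] using hle)
      have h3 := Nat.le_of_dvd hodd.pos ((cycle_pow_eq_self hτ o e).1 h2)
      have := hodd.pos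
      omega
    rw [hy] at h1
    simp only [h0, le_refl, if_true, if_neg hyo] at h1
    omega

/-! ### Doubled cycles -/

/-- The doubling of `σ`: every position `c` becomes the pair `2 * c`, `2 * c + 1` of adjacent
positions, and each pair is mapped to the next one with its two members exchanged. -/
def doublePerm {d : ℕ} (σ : Equiv.Perm (Fin d)) : Equiv.Perm (Fin (d * 2)) :=
  finProdFinEquiv.permCongr (Equiv.prodCongr σ Fin.revPerm)

theorem val_doublePerm {d : ℕ} (σ : Equiv.Perm (Fin d)) (x : Fin (d * 2)) :
    (doublePerm σ x : ℕ) = 2 * σ x.divNat + (1 - x % 2) := by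
  have := Nat.mod_lt (x : ℕ) two_pos
  simp [doublePerm, Equiv.permCongr_apply, finProdFinEquiv, Fin.val_rev]
  omega

theorem val_divNat_two {d : ℕ} (x : Fin (d * 2)) : (x.divNat : ℕ) = x / 2 := rfl

theorem divNat_doublePerm {d : ℕ} (σ : Equiv.Perm (Fin d)) (x : Fin (d * 2)) :
    (doublePerm σ x).divNat = σ x.divNat := by
  apply Fin.ext
  rw [val_divNat_two, val_doublePerm]
  omega

theorem divNat_doublePerm_pow {d : ℕ} (σ : Equiv.Perm (Fin d)) (m : ℕ) (x : Fin (d * 2)) :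
    ((doublePerm σ ^ m) x).divNat = (σ ^ m) x.divNat := by
  induction m with
  | zero => rfl
  | succ m ih =>
    rw [pow_succ', Equiv.Perm.mul_apply, divNat_doublePerm, ih, pow_succ', Equiv.Perm.mul_apply]

theorem doublePerm_pow_mod_two {d : ℕ} (σ : Equiv.Perm (Fin d)) (m : ℕ) (x : Fin (d * 2)) :
    ((doublePerm σ ^ m) x : ℕ) % 2 = (x + m) % 2 := by
  induction m with
  | zero => rfl
  | succ m ih =>
    rw [pow_succ', Equiv.Perm.mul_apply, val_doublePerm]
    omega

theorem doublePerm_injective {d : ℕ} :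
    Function.Injective (doublePerm : Equiv.Perm (Fin d) → Equiv.Perm (Fin (d * 2))) := by
  intro σ ρ h
  ext1 c
  have h1 := divNat_doublePerm σ ⟨c * 2, by omega⟩
  have h2 := divNat_doublePerm ρ ⟨c * 2, by omega⟩
  have hc : Fin.divNat (⟨c * 2, by omega⟩ : Fin (d * 2)) = c :=
    Fin.ext (by rw [val_divNat_two]; simp)
  rw [h, hc] at h1
  rw [hc] at h2
  exact h1.symm.trans h2

/-- When the length of `σ` is odd, going once around `σ` exchanges the two members of every pair,
so a single orbit of the doubling contains both. -/
theorem doublePerm_isCycleOn {d : ℕ} (hd : Odd d) {σ : Equiv.Perm (Fin d)}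
    (hσ : σ.IsCycleOn Set.univ) : (doublePerm σ).IsCycleOn Set.univ := by
  refine ⟨(doublePerm σ).bijective.bijOn_univ, fun x _ y _ => ?_⟩
  obtain ⟨m, -, hm⟩ := cycle_exists_pow hσ x.divNat y.divNat
  have key : ∀ N, (σ ^ N) x.divNat = y.divNat → (x + N) % 2 = (y : ℕ) % 2 →
      (doublePerm σ).SameCycle x y := by
    intro N h1 h2
    refine ⟨N, ?_⟩
    rw [zpow_natCast]
    apply Fin.ext
    have h3 := congrArg Fin.val (divNat_doublePerm_pow σ N x)
    have h4 := doublePerm_pow_mod_two σ N x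
    rw [h1, val_divNat_two, val_divNat_two] at h3
    omega
  by_cases h : (x + m) % 2 = (y : ℕ) % 2
  · exact key m hm h
  · refine key (m + d) ?_ (by grind)
    rw [pow_add, cycle_pow_card hσ, mul_one, hm]

theorem ascCount_doublePerm {d : ℕ} (σ : Equiv.Perm (Fin d)) :
    ascCount (doublePerm σ) = ascCount σ := by
  symm
  refine Finset.card_bij (fun i _ => (⟨2 * i + 1, by omega⟩ : Fin (d * 2))) ?_ ?_ ?_
  · intro i hi
    obtain ⟨j, hj, hlt⟩ := (Finset.mem_filter.1 hi).2
    refine Finset.mem_filter.2 ⟨Finset.mem_univ _, ⟨2 * j, by omega⟩, by simp; omega, ?_⟩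
    rw [Fin.lt_def, val_doublePerm, val_doublePerm]
    have h1 : Fin.divNat (⟨2 * i + 1, by omega⟩ : Fin (d * 2)) = i :=
      Fin.ext (by rw [val_divNat_two]; dsimp only; omega)
    have h2 : Fin.divNat (⟨2 * j, by omega⟩ : Fin (d * 2)) = j :=
      Fin.ext (by rw [val_divNat_two]; dsimp only; omega)
    rw [h1, h2]
    dsimp only
    omega
  · intro i _ j _ h
    have := Fin.val_eq_of_eq h
    exact Fin.ext (by dsimp only at this; omega)
  · intro x hx
    obtain ⟨y, hy, hlt⟩ := (Finset.mem_filter.1 hx).2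
    rw [Fin.lt_def, val_doublePerm, val_doublePerm] at hlt
    have h1 := val_divNat_two x
    have h2 := val_divNat_two y
    by_cases hpar : (x : ℕ) % 2 = 0
    · have : x.divNat = y.divNat := Fin.ext (by omega)
      rw [this] at hlt
      omega
    · refine ⟨x.divNat, Finset.mem_filter.2 ⟨Finset.mem_univ _, y.divNat, by omega, ?_⟩,
        Fin.ext (by dsimp only; omega)⟩
      have hne : σ x.divNat ≠ σ y.divNat := fun h => by
        have := Fin.val_eq_of_eq (σ.injective h)
        omega
      have := Fin.val_ne_of_ne hne
      exact Fin.lt_def.2 (by omega)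

theorem ascBefore_doublePerm_congr {d : ℕ} (σ : Equiv.Perm (Fin d)) {x y : Fin (d * 2)}
    (h : x.divNat = y.divNat) : ascBefore (doublePerm σ) x = ascBefore (doublePerm σ) y := by
  wlog hxy : x ≤ y generalizing x y
  · exact (this h.symm (not_le.1 hxy).le).symm
  rcases hxy.eq_or_lt with rfl | hxy
  · rfl
  have h1 := congrArg Fin.val h
  rw [val_divNat_two, val_divNat_two] at h1
  rw [Fin.lt_def] at hxy
  refine (ascBefore_succ_of_not_lt _ (p := x) (q := y) (by omega) ?_).symm
  rw [Fin.lt_def, val_doublePerm, val_doublePerm, h]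
  omega

/-- If opposite positions of a cycle always have the same letter in the labeling by ascents, then
they are adjacent: a position between them would share their itinerary. -/
theorem not_between_opposite {d : ℕ} {τ : Equiv.Perm (Fin (d * 2))} (hτ : τ.IsCycleOn Set.univ)
    {α : Type*} [PartialOrder α] {L : Fin (d * 2) → α} (hL : IsLabeling τ L)
    (hall : ∀ x, L ((τ ^ d) x) = L x) (x z : Fin (d * 2)) : ¬ (x < z ∧ z < (τ ^ d) x) := by
  rintro ⟨hxz, hzx⟩
  have hlab : ∀ a b c : Fin (d * 2), a < b → b < c → L a = L c → L b = L a := fun a b c h1 h2 h =>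
    le_antisymm ((hL.monotone h2.le).trans h.ge) (hL.monotone h1.le)
  have hbetween : ∀ m, ((τ ^ m) x < (τ ^ m) z ∧ (τ ^ m) z < (τ ^ d) ((τ ^ m) x)) ∨
      ((τ ^ d) ((τ ^ m) x) < (τ ^ m) z ∧ (τ ^ m) z < (τ ^ m) x) := by
    intro m
    induction m with
    | zero => exact Or.inl ⟨hxz, hzx⟩
    | succ m ih =>
      have hcomm : (τ ^ d) (τ ((τ ^ m) x)) = τ ((τ ^ d) ((τ ^ m) x)) := by
        rw [← Equiv.Perm.mul_apply, ← pow_succ, pow_succ', Equiv.Perm.mul_apply]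
      simp only [pow_succ' τ m, Equiv.Perm.mul_apply, hcomm]
      have hd := hall ((τ ^ m) x)
      rcases ih with ⟨h1, h2⟩ | ⟨h1, h2⟩
      · have := hlab _ _ _ h1 h2 hd.symm
        exact Or.inr ⟨hL.anti _ _ h2 (this.trans hd.symm), hL.anti _ _ h1 this.symm⟩
      · have := hlab _ _ _ h1 h2 hd
        exact Or.inl ⟨hL.anti _ _ h2 (this.trans hd), hL.anti _ _ h1 this.symm⟩
  have hit : itinerary τ L x = itinerary τ L z := by
    funext m
    have hd := hall ((τ ^ m) x)
    rcases hbetween m with ⟨h1, h2⟩ | ⟨h1, h2⟩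
    · exact (hlab _ _ _ h1 h2 hd.symm).symm
    · exact ((hlab _ _ _ h1 h2 hd).trans hd).symm
  obtain ⟨e, he, -, hz, -⟩ := opposite_of_itinerary_eq hτ hL hxz.ne hit
  obtain rfl : e = d := by omega
  exact hzx.ne hz

/-- Opposite positions that always share a letter are the two members of a pair `2 * c`,
`2 * c + 1`: they are adjacent by `not_between_opposite`, and the matching of `Fin (d * 2)` by
adjacent pairs is unique, as one sees from the left end. -/
theorem val_opposite {d : ℕ} {τ : Equiv.Perm (Fin (d * 2))} (hτ : τ.IsCycleOn Set.univ)
    {α : Type*} [PartialOrder α] {L : Fin (d * 2) → α} (hL : IsLabeling τ L)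
    (hall : ∀ x, L ((τ ^ d) x) = L x) (x : Fin (d * 2)) :
    ((τ ^ d) x : ℕ) = if (x : ℕ) % 2 = 0 then (x : ℕ) + 1 else x - 1 := by
  have hinv : ∀ x, (τ ^ d) ((τ ^ d) x) = x := fun x => by
    rw [← Equiv.Perm.mul_apply, ← pow_add, ← mul_two, cycle_pow_card hτ]; rfl
  have hne : ∀ x, (τ ^ d) x ≠ x := fun x h => by
    have := x.2
    have := Nat.le_of_dvd (by omega) ((cycle_pow_eq_self hτ x d).1 h)
    omega
  have hadj : ∀ x, ((τ ^ d) x : ℕ) = x + 1 ∨ ((τ ^ d) x : ℕ) + 1 = x := by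
    intro x
    rcases lt_or_gt_of_ne (hne x) with h | h
    · right
      by_contra hn
      have h' := Fin.lt_def.1 h
      refine not_between_opposite hτ hL hall ((τ ^ d) x) ⟨(τ ^ d) x + 1, by omega⟩
        ⟨Fin.lt_def.2 (by dsimp only; omega), ?_⟩
      rw [hinv]
      exact Fin.lt_def.2 (by dsimp only; omega)
    · left
      by_contra hn
      have h' := Fin.lt_def.1 h
      exact not_between_opposite hτ hL hall x ⟨x + 1, by omega⟩
        ⟨Fin.lt_def.2 (by dsimp only; omega), Fin.lt_def.2 (by dsimp only; omega)⟩
  have heven : ∀ c (hc : 2 * c < d * 2), ((τ ^ d) ⟨2 * c, hc⟩ : ℕ) = 2 * c + 1 := by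
    intro c
    induction c with
    | zero => intro hc; exact (hadj _).resolve_right (by simp)
    | succ c ih =>
      intro hc
      refine (hadj _).resolve_right fun h => ?_
      have h1 := ih (by omega)
      have h2 : (τ ^ d) ⟨2 * (c + 1), hc⟩ = (τ ^ d) ⟨2 * c, by omega⟩ :=
        Fin.ext (by rw [h1]; dsimp only at h; omega)
      have := Fin.val_eq_of_eq ((τ ^ d).injective h2)
      dsimp only at this
      omega
  split_ifs with hpar
  · have := heven (x / 2) (by omega)
    have hx : (⟨2 * (x / 2), by omega⟩ : Fin (d * 2)) = x := Fin.ext (by dsimp only; omega)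
    rw [hx] at this
    omega
  · have := heven (x / 2) (by omega)
    have hx : (τ ^ d) (⟨2 * (x / 2), by omega⟩ : Fin (d * 2)) = x := Fin.ext (by omega)
    rw [← hx, hinv, hx]
    dsimp only
    omega

/-- The exceptional cycles are doublings: `τ` commutes with the exchange of opposite positions, so
it permutes the adjacent pairs, and it reverses each pair because the two members share a letter. -/
theorem exists_doublePerm_eq {d : ℕ} {τ : Equiv.Perm (Fin (d * 2))} (hτ : τ.IsCycleOn Set.univ)
    (hall : ∀ x, ascBefore τ ((τ ^ d) x) = ascBefore τ x) :
    ∃ σ : Equiv.Perm (Fin d), σ.IsCycleOn Set.univ ∧ doublePerm σ = τ := by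
  have hL := isLabeling_ascBefore τ
  have hop := val_opposite hτ hL hall
  have hcomm : ∀ x, (τ ^ d) (τ x) = τ ((τ ^ d) x) := fun x => by
    rw [← Equiv.Perm.mul_apply, ← pow_succ, pow_succ', Equiv.Perm.mul_apply]
  -- The parity of the image tells which member of its pair is hit.
  have hpar : ∀ x, (τ x : ℕ) % 2 = 1 - x % 2 := by
    intro x
    have h1 := hop x
    have h2 := hop (τ x)
    rw [hcomm] at h2
    split_ifs at h1 with hx
    · have h3 := Fin.lt_def.1 (hL.anti x ((τ ^ d) x) (Fin.lt_def.2 (by omega)) (hall x).symm)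
      split_ifs at h2 <;> omega
    · have h3 := Fin.lt_def.1 (hL.anti ((τ ^ d) x) x (Fin.lt_def.2 (by omega)) (hall x))
      split_ifs at h2 <;> omega
  let u : Fin d → Fin (d * 2) := fun c => ⟨2 * c, by omega⟩
  have hu : ∀ c, (u c).divNat = c := fun c =>
    Fin.ext (by rw [val_divNat_two]; dsimp only [u]; omega)
  have hpair : ∀ x, (τ x).divNat = (τ (u x.divNat)).divNat := by
    intro x
    have h0 := val_divNat_two x
    by_cases hx : (x : ℕ) % 2 = 0
    · rw [show u x.divNat = x from Fin.ext (by dsimp only [u]; omega)]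
    · have h1 := hop (u x.divNat)
      rw [if_pos (by dsimp only [u]; omega)] at h1
      have h2 : (τ ^ d) (u x.divNat) = x := Fin.ext (by rw [h1]; dsimp only [u]; omega)
      have h3 := hop (τ (u x.divNat))
      rw [hcomm, h2] at h3
      have h4 := hpar (u x.divNat)
      have h5 : (u x.divNat : ℕ) % 2 = 0 := by dsimp only [u]; omega
      rw [if_neg (by omega)] at h3
      apply Fin.ext
      rw [val_divNat_two, val_divNat_two]
      omega
  have hinj : Function.Injective fun c => (τ (u c)).divNat := by
    intro a b h
    have h1 := congrArg Fin.val h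
    dsimp only at h1
    rw [val_divNat_two, val_divNat_two] at h1
    have ha := hpar (u a)
    have hb := hpar (u b)
    have ha' : (u a : ℕ) % 2 = 0 := by dsimp only [u]; omega
    have hb' : (u b : ℕ) % 2 = 0 := by dsimp only [u]; omega
    have h2 : τ (u a) = τ (u b) := Fin.ext (by omega)
    rw [← hu a, τ.injective h2, hu]
  let σ : Equiv.Perm (Fin d) := Equiv.ofBijective _ (Finite.injective_iff_bijective.1 hinj)
  have hσ : doublePerm σ = τ := by
    ext1 x
    apply Fin.ext
    rw [val_doublePerm, ← hpar]
    have h1 : σ x.divNat = (τ x).divNat := (hpair x).symm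
    rw [h1, val_divNat_two]
    omega
  refine ⟨σ, ⟨σ.bijective.bijOn_univ, fun a _ b _ => ?_⟩, hσ⟩
  obtain ⟨m, -, hm⟩ := cycle_exists_pow hτ (u a) (u b)
  refine ⟨m, ?_⟩
  rw [zpow_natCast, ← hu a, ← divNat_doublePerm_pow, hσ, hm, hu]

/-! ### The count -/

/-- Among the cyclic permutations with few enough ascents, exactly the doublings with the maximal
number of ascents are not realized. -/
theorem realizedCycles_reverseShift {d : ℕ} (k : ℕ) (hd : Odd d) :
    realizedCycles (reverseShift k) (d * 2) =
      {τ : Equiv.Perm (Fin (d * 2)) | τ.IsCycleOn Set.univ ∧ ascCount τ + 1 ≤ k} \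
        doublePerm '' {σ : Equiv.Perm (Fin d) | σ.IsCycleOn Set.univ ∧ ascCount σ + 1 = k} := by
  have hd0 : d * 2 ≠ 0 := by have := hd.pos; omega
  ext τ
  constructor
  · intro h
    obtain ⟨hτ, L, hk, hL, hinj⟩ := mem_realizedCycles_reverseShift.1 h
    refine ⟨⟨hτ, hL.ascCount_lt hd0 hk⟩, ?_⟩
    rintro ⟨σ, ⟨hσ, hasc⟩, rfl⟩
    obtain rfl := hL.eq_ascBefore hk (by rw [ascCount_doublePerm]; exact hasc)
    -- The forced labeling does not separate the members of a pair, so `0` and `1` collide.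
    have h01 : (⟨0, by omega⟩ : Fin (d * 2)) = ⟨1, by omega⟩ := by
      refine hinj (funext fun m => ascBefore_doublePerm_congr σ ?_)
      rw [divNat_doublePerm_pow, divNat_doublePerm_pow]
      exact congrArg _ (Fin.ext (by simp))
    simp at h01
  · rintro ⟨⟨hτ, hasc⟩, hnot⟩
    rcases hasc.eq_or_lt with hasc | hasc
    · refine mem_realizedCycles_reverseShift.2
        ⟨hτ, ascBefore τ, fun p => ?_, isLabeling_ascBefore τ, fun p q hpq => ?_⟩
      · have := ascBefore_le_ascCount τ p
        omega
      · by_contra hne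
        obtain ⟨e, he, -, -, hall⟩ :=
          opposite_of_itinerary_eq hτ (isLabeling_ascBefore τ) hne hpq
        obtain rfl : e = d := by omega
        obtain ⟨σ, hσ, rfl⟩ := exists_doublePerm_eq hτ hall
        exact hnot ⟨σ, ⟨hσ, by rw [← ascCount_doublePerm]; exact hasc⟩, rfl⟩
    · exact mem_realizedCycles_of_ascCount_lt hd0 hτ hasc

/-- A decreasing permutation is an involution, hence not a long cycle. -/
theorem ascCount_pos_of_isCycleOn {n : ℕ} (hn : 3 ≤ n) {τ : Equiv.Perm (Fin n)}
    (hτ : τ.IsCycleOn Set.univ) : 0 < ascCount τ := by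
  by_contra h
  have h0 : ∀ p, ascBefore τ p = 0 := fun p => by
    have := ascBefore_le_ascCount τ p
    omega
  have h2 : τ ^ 2 = 1 := pow_even_eq_one (isLabeling_ascBefore τ) even_two fun p => by
    rw [h0, h0]
  have := Nat.le_of_dvd two_pos
    ((cycle_pow_eq_self hτ ⟨0, by omega⟩ 2).1 (by rw [h2]; rfl))
  omega

theorem ncard_cycles_ascCount_le {n : ℕ} (k : ℕ) (hn : 3 ≤ n) :
    {τ : Equiv.Perm (Fin n) | τ.IsCycleOn Set.univ ∧ ascCount τ + 1 ≤ k}.ncard =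
      ∑ i ∈ Finset.Icc 2 k, numCyclicAsc n i := by
  classical
  rw [Set.ncard_eq_toFinset_card', Finset.card_eq_sum_card_fiberwise
    (f := fun τ => ascCount τ + 1) (t := Finset.Icc 2 k)]
  · refine Finset.sum_congr rfl fun i hi => ?_
    rw [numCyclicAsc, Set.ncard_eq_toFinset_card']
    congr 1
    ext τ
    simp only [Finset.mem_filter, Set.mem_toFinset, Set.mem_ofPred_eq]
    have := (Finset.mem_Icc.1 hi).2
    constructor
    · rintro ⟨⟨h1, -⟩, h2⟩
      exact ⟨h1, h2⟩
    · rintro ⟨h1, h2⟩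
      exact ⟨⟨h1, by omega⟩, h2⟩
  · intro τ hτ
    simp only [Finset.mem_coe, Set.mem_toFinset, Set.mem_ofPred_eq] at hτ
    have := ascCount_pos_of_isCycleOn hn hτ.1
    exact Finset.mem_coe.2 (Finset.mem_Icc.2 ⟨Nat.succ_le_succ this, hτ.2⟩)

theorem theorem3p15 (n k : ℕ) (hn : 3 ≤ n) (hn4 : n % 4 = 2) (hk : 3 ≤ k) :
    (numPeriodicPatterns (reverseShift k) n : ℤ) =
      (∑ i ∈ Finset.Icc 2 k, (numCyclicAsc n i : ℤ)) - (numCyclicAsc (n / 2) k : ℤ) := by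
  obtain ⟨d, rfl⟩ : ∃ d, n = d * 2 := ⟨n / 2, by omega⟩
  have hd : Odd d := Nat.odd_iff.2 (by omega)
  have hsub : doublePerm '' {σ : Equiv.Perm (Fin d) | σ.IsCycleOn Set.univ ∧ ascCount σ + 1 = k} ⊆
      {τ : Equiv.Perm (Fin (d * 2)) | τ.IsCycleOn Set.univ ∧ ascCount τ + 1 ≤ k} := by
    rintro _ ⟨σ, ⟨hσ, hasc⟩, rfl⟩
    exact ⟨doublePerm_isCycleOn hd hσ, by rw [ascCount_doublePerm]; exact hasc.le⟩
  have hcard := Set.ncard_sdiff_add_ncard_of_subset hsub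
  rw [← realizedCycles_reverseShift k hd, ← numPeriodicPatterns_eq_ncard_realizedCycles _ (by omega),
    Set.ncard_image_of_injective _ doublePerm_injective, ncard_cycles_ascCount_le k hn] at hcard
  rw [Nat.mul_div_cancel d two_pos, ← Nat.cast_sum, ← hcard, numCyclicAsc]
  push_cast
  ring
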